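/- Let $(\Omega,\mathcal F,(\mathcal F_t)_{t\ge 0},P)$ be a filtered probability space with a standard $d$-dimensional Brownian motion $B$, let $T>0$, and let $X$ be an $\mathbb R^m$-valued solution on $[0,T]$ of the stochastic differential equation $dX_t=b(t,X_t)\,dt+\sigma(t,X_t)\,dB_t$, $X_0=x\in\mathbb R^m$, with Borel measurable coefficients $b,\sigma$. Assume that each component $X^i_T$ lies in the Malliavin–Sobolev space $\mathbb D^{1,2}$, let $DX^i_T\colon\Omega\to L^2([0,T],\mathbb R^d)$ be its Malliavin derivative, and let $\gamma_{X_T}$ be the Malliavin matrix, $\gamma_{X_T}(i,j)=\langle DX^i_T,DX^j_T\rangle_{L^2([0,T])}$. Assume that $\gamma_{X_T}$ is almost surely invertible. For $k=1,\dots,m$ put $$u_k=\sum_{j=1}^m\gamma_{X_T}^{-1}(k,j)\,DX^j_T ,$$ and let $V=\operatorname{span}\{DX^1_T,\dots,DX^m_T\}\subset L^2([0,T],\mathbb R^d)$ (a random subspace). Say that $v\in L^2([0,T],\mathbb R^d)$ has the covering property for $k$ if $\langle DX^i_T,v\rangle_{L^2([0,T])}=\delta_{ik}$ for all $i=1,\dots,m$.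 Then, for every $k$: 1. Almost surely, $u_k$ is the unique element of $V$ that has the covering property for $k$. 2. Almost surely, the elements of $L^2([0,T],\mathbb R^d)$ that have the covering property for $k$ are exactly the vectors $u_k+w$ with $w\in V^\perp$, and there are infinitely many of them. Moreover, there are infinitely many strongly measurable random vector fields $U\colon\Omega\to L^2([0,T],\mathbb R^d)$, pairwise not almost surely equal, that almost surely have the covering property for $k$. -/

import Mathlib

open MeasureTheory ProbabilityTheory Filter Topology
open scoped NNReal ENNReal InnerProductSpace

namespace Malliavin

noncomputable section

/-- A standard `d`-dimensional Brownian motion relative to the filtration `𝓕`. -/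
structure IsBrownianMotion {Ω : Type*} {mΩ : MeasurableSpace Ω} {d : ℕ}
    (𝓕 : Filtration ℝ≥0 mΩ) (P : Measure Ω) (B : ℝ≥0 → Ω → EuclideanSpace ℝ (Fin d)) :
    Prop where
  coord : ∀ l : Fin d, IsBrownianReal (fun t ω => B t ω l) P
  coord_indep : iIndepFun (fun (l : Fin d) ω (t : ℝ≥0) => B t ω l) P
  adapted : StronglyAdapted 𝓕 B
  increment_indep : ∀ s t : ℝ≥0, s ≤ t →
    Indep (MeasurableSpace.comap (fun ω => B t ω - B s ω) inferInstance) (𝓕 s) P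

/-- A simple predictable `ℝ^d`-valued process `∑ j, ξ j * 1_{(left j, right j]}` with bounded
coefficients `ξ j` that are `𝓕 (left j)`-measurable. -/
structure SimpleProcess {Ω : Type*} {mΩ : MeasurableSpace Ω} (𝓕 : Filtration ℝ≥0 mΩ)
    (d : ℕ) where
  size : ℕ
  left : Fin size → ℝ≥0
  right : Fin size → ℝ≥0
  left_le_right : ∀ j, left j ≤ right j
  coeff : Fin size → Ω → EuclideanSpace ℝ (Fin d)
  measurable_coeff : ∀ j, StronglyMeasurable[𝓕 (left j)] (coeff j)
  bounded_coeff : ∃ C : ℝ, ∀ j ω, ‖coeff j ω‖ ≤ C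

/-- The value of a simple process at time `r`. -/
def SimpleProcess.eval {Ω : Type*} {mΩ : MeasurableSpace Ω} {𝓕 : Filtration ℝ≥0 mΩ} {d : ℕ}
    (S : SimpleProcess 𝓕 d) (r : ℝ) (ω : Ω) : EuclideanSpace ℝ (Fin d) :=
  ∑ j, Set.indicator (Set.Ioc (S.left j : ℝ) (S.right j : ℝ)) (fun _ => S.coeff j ω) r

/-- The elementary stochastic integral `∫_0^t S_r · dB_r` of a simple process. -/
def SimpleProcess.integral {Ω : Type*} {mΩ : MeasurableSpace Ω} {𝓕 : Filtration ℝ≥0 mΩ} {d : ℕ}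
    (S : SimpleProcess 𝓕 d) (B : ℝ≥0 → Ω → EuclideanSpace ℝ (Fin d)) (t : ℝ≥0) (ω : Ω) : ℝ :=
  ∑ j, ⟪S.coeff j ω, B (min (S.right j) t) ω - B (min (S.left j) t) ω⟫_ℝ

/-- `I` is (a version of) the Itô integral process `t ↦ ∫_0^t φ_r · dB_r`, `0 ≤ t ≤ T`: there are
simple processes `S n` with `∫_0^T |S n - φ|² dr → 0` in probability and
`sup_{t ≤ T} |∫_0^t S n · dB - I t| → 0` in probability. -/
def IsItoIntegral {Ω : Type*} {mΩ : MeasurableSpace Ω} {d : ℕ} (𝓕 : Filtration ℝ≥0 mΩ)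
    (P : Measure Ω) (B : ℝ≥0 → Ω → EuclideanSpace ℝ (Fin d)) (T : ℝ≥0)
    (φ : ℝ → Ω → EuclideanSpace ℝ (Fin d)) (I : ℝ≥0 → Ω → ℝ) : Prop :=
  ∃ S : ℕ → SimpleProcess 𝓕 d,
    (∀ ε : ℝ≥0∞, 0 < ε → Tendsto
      (fun n => P {ω | ε ≤ ∫⁻ r in Set.Icc (0 : ℝ) T, ‖(S n).eval r ω - φ r ω‖ₑ ^ 2})
      atTop (𝓝 0)) ∧
    (∀ ε : ℝ≥0∞, 0 < ε → Tendsto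
      (fun n => P {ω | ε ≤ ⨆ t : Set.Iic T, ‖(S n).integral B t ω - I t ω‖ₑ})
      atTop (𝓝 0))

/-- `X` is a solution on `[0, T]` of `dX_t = b(t, X_t) dt + σ(t, X_t) dB_t`, `X_0 = x`. -/
structure IsSDESolution {Ω : Type*} {mΩ : MeasurableSpace Ω} {d m : ℕ}
    (𝓕 : Filtration ℝ≥0 mΩ) (P : Measure Ω) (B : ℝ≥0 → Ω → EuclideanSpace ℝ (Fin d))
    (T : ℝ≥0) (b : ℝ → EuclideanSpace ℝ (Fin m) → EuclideanSpace ℝ (Fin m))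
    (σ : ℝ → EuclideanSpace ℝ (Fin m) → Matrix (Fin m) (Fin d) ℝ)
    (x : EuclideanSpace ℝ (Fin m)) (X : ℝ≥0 → Ω → EuclideanSpace ℝ (Fin m)) : Prop where
  adapted : StronglyAdapted 𝓕 X
  continuousOn : ∀ᵐ ω ∂P, ContinuousOn (fun t => X t ω) (Set.Iic T)
  drift_integrable : ∀ᵐ ω ∂P,
    IntervalIntegrable (fun r => b r (X r.toNNReal ω)) volume 0 T
  diffusion_integrable : ∀ᵐ ω ∂P, ∀ (i : Fin m) (l : Fin d),
    ∫⁻ r in Set.Icc (0 : ℝ) T, ‖σ r (X r.toNNReal ω) i l‖ₑ ^ 2 < ∞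
  equation : ∃ M : Fin m → ℝ≥0 → Ω → ℝ,
    (∀ i, IsItoIntegral 𝓕 P B T
      (fun r ω => WithLp.toLp 2 (fun l => σ r (X r.toNNReal ω) i l)) (M i)) ∧
    ∀ᵐ ω ∂P, ∀ t ≤ T, ∀ i,
      X t ω i = x i + (∫ r in (0 : ℝ)..t, b r (X r.toNNReal ω)) i + M i t ω

/-- The Hilbert space `L²([0, T], ℝ^d)`. -/
abbrev H (T : ℝ≥0) (d : ℕ) : Type :=
  Lp (EuclideanSpace ℝ (Fin d)) 2 (volume.restrict (Set.Icc (0 : ℝ) T))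

/-- `W` is (a version of) the Wiener integral `B(h) = ∫_0^T h(t) · dB_t`. -/
def IsWienerIntegral {Ω : Type*} {mΩ : MeasurableSpace Ω} {d : ℕ} (𝓕 : Filtration ℝ≥0 mΩ)
    (P : Measure Ω) (B : ℝ≥0 → Ω → EuclideanSpace ℝ (Fin d)) (T : ℝ≥0)
    (h : H T d) (W : Ω → ℝ) : Prop :=
  ∃ I : ℝ≥0 → Ω → ℝ, IsItoIntegral 𝓕 P B T (fun r _ => h r) I ∧ W =ᵐ[P] I T

/-- `F = f(B(h_1), …, B(h_n))` is a smooth cylindrical functional, `f` being smooth with all its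
derivatives of polynomial growth, and `DF = ∑ i, ∂_i f(B(h_1), …, B(h_n)) h_i`. -/
def IsCylindricalWithDeriv {Ω : Type*} {mΩ : MeasurableSpace Ω} {d : ℕ}
    (𝓕 : Filtration ℝ≥0 mΩ) (P : Measure Ω) (B : ℝ≥0 → Ω → EuclideanSpace ℝ (Fin d))
    (T : ℝ≥0) (F : Ω → ℝ) (DF : Ω → H T d) : Prop :=
  ∃ (n : ℕ) (f : EuclideanSpace ℝ (Fin n) → ℝ) (h : Fin n → H T d)
    (W : Fin n → Ω → ℝ),
    f.HasTemperateGrowth ∧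
    (∀ i, IsWienerIntegral 𝓕 P B T (h i) (W i)) ∧
    (∀ ω, F ω = f (WithLp.toLp 2 (fun i => W i ω))) ∧
    ∀ ω, DF ω = ∑ i,
      fderiv ℝ f (WithLp.toLp 2 (fun i => W i ω)) (EuclideanSpace.single i 1) • h i

/-- `F` belongs to the Malliavin–Sobolev space `𝔻^{1,2}` and `DF` is (a version of) its Malliavin
derivative, i.e. `(F, DF)` lies in the graph of the closure, in `L²(Ω) × L²(Ω; L²([0, T], ℝ^d))`,
of the derivative operator on smooth cylindrical functionals. -/
def IsMalliavinDeriv {Ω : Type*} {mΩ : MeasurableSpace Ω} {d : ℕ} (𝓕 : Filtration ℝ≥0 mΩ)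
    (P : Measure Ω) (B : ℝ≥0 → Ω → EuclideanSpace ℝ (Fin d)) (T : ℝ≥0)
    (F : Ω → ℝ) (DF : Ω → H T d) : Prop :=
  MemLp F 2 P ∧ MemLp DF 2 P ∧
  ∃ (G : ℕ → Ω → ℝ) (DG : ℕ → Ω → H T d),
    (∀ n, IsCylindricalWithDeriv 𝓕 P B T (G n) (DG n)) ∧
    Tendsto (fun n => eLpNorm (fun ω => G n ω - F ω) 2 P) atTop (𝓝 0) ∧
    Tendsto (fun n => eLpNorm (fun ω => DG n ω - DF ω) 2 P) atTop (𝓝 0)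

/-- The Malliavin matrix `γ(i, j) = ⟨DX^i, DX^j⟩`. -/
def malliavinMatrix {Ω : Type*} {m d : ℕ} {T : ℝ≥0} (DX : Fin m → Ω → H T d) (ω : Ω) :
    Matrix (Fin m) (Fin m) ℝ :=
  Matrix.of fun i j => ⟪DX i ω, DX j ω⟫_ℝ

/-- The covering vector field `u_k = ∑ j, γ⁻¹(k, j) DX^j`. -/
def coveringField {Ω : Type*} {m d : ℕ} {T : ℝ≥0} (DX : Fin m → Ω → H T d) (k : Fin m)
    (ω : Ω) : H T d :=
  ∑ j, (malliavinMatrix DX ω)⁻¹ k j • DX j ω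

/-- The subspace `V = span {DX^1, …, DX^m}` of `L²([0, T], ℝ^d)`. -/
def derivSpan {Ω : Type*} {m d : ℕ} {T : ℝ≥0} (DX : Fin m → Ω → H T d) (ω : Ω) :
    Submodule ℝ (H T d) :=
  Submodule.span ℝ (Set.range fun i => DX i ω)

/-- The covering property at `ω` for the index `k`: `⟨DX^i, v⟩ = δ_{ik}` for all `i`. -/
def Covers {Ω : Type*} {m d : ℕ} {T : ℝ≥0} (DX : Fin m → Ω → H T d) (k : Fin m) (ω : Ω)
    (v : H T d) : Prop :=
  ∀ i, ⟪DX i ω, v⟫_ℝ = if i = k then 1 else 0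

end

end Malliavin

/-!
If the Gram matrix of `DX¹, …, DXᵐ` is invertible, these vectors have a biorthogonal basis
`u₁, …, uₘ` in their span `V`, and the difference of two vectors with the covering property for `k`
is orthogonal to `V`. The solutions therefore form the affine space `u_k + Vᗮ`, which meets `V` in
the single point `u_k` and is infinite because `L²` is infinite-dimensional.

For random fields one needs a measurable `W` with values in `Vᗮ` that is not almost surely zero.
Choose `m + 1` fixed linearly independent vectors. They can never all lie in `V`, so one of them,
`x`, is not almost surely in `V`, and `W = x - proj_V x` works. It is measurable because
`proj_V x = ∑ j, ⟪DXʲ, x⟫ u_j`. The fields `u_k + c W` are then pairwise different.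
-/

section VectorSpace

theorem infinite_of_forall_add_smul_mem {R M : Type*} [Ring R] [IsDomain R] [Infinite R]
    [AddCommGroup M] [Module R M] [Module.IsTorsionFree R M] {s : Set M} {x y : M} (hy : y ≠ 0)
    (h : ∀ c : R, x + c • y ∈ s) : s.Infinite :=
  Set.infinite_of_injective_forall_mem
    ((add_right_injective x).comp (smul_left_injective R hy)) h

theorem exists_finset_forall_exists_notMem_span {R M ι : Type*} [Ring R] [StrongRankCondition R]
    [AddCommGroup M] [Module R M] [Fintype ι] (hrank : Fintype.card ι < Module.rank R M) :
    ∃ s : Finset M, ∀ v : ι → M, ∃ x ∈ s, x ∉ Submodule.span R (Set.range v) := by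
  have := nontrivial_of_invariantBasisNumber R
  obtain ⟨s, hcard, hs⟩ := Module.le_rank_iff_exists_finset.1
    (show ((Fintype.card ι + 1 : ℕ) : Cardinal) ≤ Module.rank R M from
      mod_cast Cardinal.add_one_le_of_lt hrank)
  refine ⟨s, fun v => ?_⟩
  by_contra! hspan
  classical
  have hsub : Set.range (fun x : (s : Set M) => (x : M)) ⊆ Submodule.span R (Set.range v) := by
    rintro _ ⟨x, rfl⟩
    exact hspan x x.2
  have hle := linearIndependent_le_span' _ hs (Set.range v) hsub
  have hle' : s.card ≤ Fintype.card (Set.range v) :=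
    Nat.cast_le.1 (Cardinal.mk_coe_finset.ge.trans hle)
  have hrange := Fintype.card_range_le v
  omega

end VectorSpace

section DualVector

variable {𝕜 E ι : Type*} [RCLike 𝕜] [NormedAddCommGroup E] [InnerProductSpace 𝕜 E]

variable (𝕜) in
/-- The vector `u` satisfies the duality relations `⟪v i, u⟫ = δ_{ik}` with respect to the family
`v`: this is the covering property of a single realisation of the derivatives. -/
def IsDualVector [DecidableEq ι] (v : ι → E) (k : ι) (u : E) : Prop :=
  ∀ i, ⟪v i, u⟫_𝕜 = if i = k then 1 else 0

variable (𝕜) in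
/-- The `k`-th member of the basis of `span (range v)` biorthogonal to `v`. The inner product is
conjugate-linear in its first argument, so the coefficients are the `k`-th column of the inverse
Gram matrix. When the Gram matrix is singular, its inverse and hence this vector are `0`. -/
noncomputable def dualVector [Fintype ι] [DecidableEq ι] (v : ι → E) (k : ι) : E :=
  ∑ j, (Matrix.gram 𝕜 v)⁻¹ j k • v j

theorem mem_orthogonal_span_range_iff {v : ι → E} {w : E} :
    w ∈ (Submodule.span 𝕜 (Set.range v))ᗮ ↔ ∀ i, ⟪v i, w⟫_𝕜 = 0 := by
  rw [← Submodule.span_singleton_le_iff_mem, ← Submodule.isOrtho_iff_le, Submodule.isOrtho_comm,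
    Submodule.isOrtho_span]
  simp only [Set.forall_mem_range, Set.mem_singleton_iff, forall_eq]

instance finiteDimensional_span_range [Finite ι] (v : ι → E) :
    FiniteDimensional 𝕜 (Submodule.span 𝕜 (Set.range v)) :=
  FiniteDimensional.span_of_finite 𝕜 (Set.finite_range v)

namespace IsDualVector

variable [DecidableEq ι] {v : ι → E} {k : ι} {u u' : E}

theorem iff_sub_mem_orthogonal (hu : IsDualVector 𝕜 v k u) :
    IsDualVector 𝕜 v k u' ↔ u' - u ∈ (Submodule.span 𝕜 (Set.range v))ᗮ := by
  simp only [mem_orthogonal_span_range_iff, inner_sub_right, hu _, sub_eq_zero, IsDualVector]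

theorem iff_exists_eq_add (hu : IsDualVector 𝕜 v k u) :
    IsDualVector 𝕜 v k u' ↔ ∃ w ∈ (Submodule.span 𝕜 (Set.range v))ᗮ, u' = u + w := by
  rw [hu.iff_sub_mem_orthogonal]
  exact ⟨fun h => ⟨_, h, (add_sub_cancel _ _).symm⟩,
    fun ⟨w, hw, h⟩ => by rwa [h, add_sub_cancel_left]⟩

theorem eq_of_mem_span (hu : IsDualVector 𝕜 v k u) (hu' : IsDualVector 𝕜 v k u')
    (hmem : u ∈ Submodule.span 𝕜 (Set.range v)) (hmem' : u' ∈ Submodule.span 𝕜 (Set.range v)) :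
    u' = u :=
  sub_eq_zero.1 <| Submodule.disjoint_def.1 (Submodule.orthogonal_disjoint _) _
    (Submodule.sub_mem _ hmem' hmem) (hu.iff_sub_mem_orthogonal.1 hu')

theorem infinite_setOf [Fintype ι] (hu : IsDualVector 𝕜 v k u)
    (hrank : Fintype.card ι < Module.rank 𝕜 E) : {u' | IsDualVector 𝕜 v k u'}.Infinite := by
  obtain ⟨s, hs⟩ := exists_finset_forall_exists_notMem_span hrank
  obtain ⟨x, -, hx⟩ := hs v
  have hspan : (Submodule.span 𝕜 (Set.range v))ᗮ ≠ ⊥ := fun h =>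
    hx (by simp [(Submodule.orthogonal_eq_bot_iff).1 h])
  obtain ⟨w, hw, hw0⟩ := Submodule.exists_mem_ne_zero_of_ne_bot hspan
  exact infinite_of_forall_add_smul_mem (R := 𝕜) hw0 fun c =>
    hu.iff_exists_eq_add.2 ⟨c • w, Submodule.smul_mem _ c hw, rfl⟩

end IsDualVector

variable [Fintype ι] [DecidableEq ι]

theorem dualVector_mem_span (v : ι → E) (k : ι) :
    dualVector 𝕜 v k ∈ Submodule.span 𝕜 (Set.range v) :=
  Submodule.sum_mem _ fun j _ =>
    Submodule.smul_mem _ _ (Submodule.subset_span (Set.mem_range_self j))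

theorem isDualVector_dualVector {v : ι → E} (hv : IsUnit (Matrix.gram 𝕜 v)) (k : ι) :
    IsDualVector 𝕜 v k (dualVector 𝕜 v k) := fun i => by
  calc ⟪v i, dualVector 𝕜 v k⟫_𝕜 = (Matrix.gram 𝕜 v * (Matrix.gram 𝕜 v)⁻¹) i k := by
        simp only [dualVector, inner_sum, inner_smul_right, Matrix.mul_apply, Matrix.gram_apply,
          mul_comm]
    _ = if i = k then 1 else 0 := by
        rw [Matrix.mul_nonsing_inv _ ((Matrix.isUnit_iff_isUnit_det _).1 hv), Matrix.one_apply]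

theorem starProjection_span_range_eq_sum {v : ι → E} (hv : IsUnit (Matrix.gram 𝕜 v)) (x : E) :
    (Submodule.span 𝕜 (Set.range v)).starProjection x = ∑ j, ⟪v j, x⟫_𝕜 • dualVector 𝕜 v j := by
  refine Submodule.eq_starProjection_of_mem_orthogonal
    (Submodule.sum_mem _ fun j _ => Submodule.smul_mem _ _ (dualVector_mem_span v j))
    (mem_orthogonal_span_range_iff.2 fun i => ?_)
  simp only [inner_sub_right, inner_sum, inner_smul_right, isDualVector_dualVector hv _ i,
    mul_ite, mul_one, mul_zero, Finset.sum_ite_eq, Finset.mem_univ, if_true, sub_self]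

end DualVector

section RandomVectors

variable {Ω : Type*} {mΩ : MeasurableSpace Ω} {P : Measure Ω}

section Matrix

variable {n R : Type*} [Fintype n] [DecidableEq n] [TopologicalSpace R] {A : Ω → Matrix n n R}

theorem aestronglyMeasurable_matrix_det [CommRing R] [IsTopologicalRing R]
    (hA : ∀ i j, AEStronglyMeasurable (fun ω => A ω i j) P) :
    AEStronglyMeasurable (fun ω => (A ω).det) P := by
  simp only [Matrix.det_apply]
  exact Finset.aestronglyMeasurable_fun_sum _ fun τ _ =>
    (Finset.aestronglyMeasurable_fun_prod _ fun i _ => hA (τ i) i).const_smul _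

theorem aestronglyMeasurable_matrix_inv_apply [Field R] [IsTopologicalRing R] [ContinuousInv₀ R]
    [TopologicalSpace.MetrizableSpace R]
    (hA : ∀ i j, AEStronglyMeasurable (fun ω => A ω i j) P) (i j : n) :
    AEStronglyMeasurable (fun ω => (A ω)⁻¹ i j) P := by
  simp only [Matrix.inv_def, Ring.inverse_eq_inv', Matrix.smul_apply, Matrix.adjugate_apply]
  refine (aestronglyMeasurable_matrix_det hA).inv₀.smul
    (aestronglyMeasurable_matrix_det fun a b => ?_)
  by_cases ha : a = j
  · simp only [ha, Matrix.updateRow_self, aestronglyMeasurable_const]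
  · simpa only [Matrix.updateRow_ne ha] using hA a b

end Matrix

variable {𝕜 E ι : Type*} [RCLike 𝕜] [NormedAddCommGroup E] [InnerProductSpace 𝕜 E] [Fintype ι]

theorem exists_not_ae_mem_span [NeZero P] (hrank : Fintype.card ι < Module.rank 𝕜 E)
    (v : ι → Ω → E) :
    ∃ x, ¬ ∀ᵐ ω ∂P, x ∈ Submodule.span 𝕜 (Set.range fun i => v i ω) := by
  obtain ⟨s, hs⟩ := exists_finset_forall_exists_notMem_span hrank
  by_contra! hspan
  obtain ⟨ω, hω⟩ := ((ae_ball_iff s.countable_toSet).2 fun x _ => hspan x).exists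
  obtain ⟨x, hxs, hx⟩ := hs fun i => v i ω
  exact hx (hω x hxs)

variable [DecidableEq ι] {v : ι → Ω → E}

theorem aestronglyMeasurable_dualVector (hv : ∀ i, AEStronglyMeasurable (v i) P) (k : ι) :
    AEStronglyMeasurable (fun ω => dualVector 𝕜 (fun i => v i ω) k) P :=
  Finset.aestronglyMeasurable_fun_sum _ fun j _ =>
    (aestronglyMeasurable_matrix_inv_apply (fun i l => (hv i).inner (hv l)) j k).smul (hv j)

theorem aestronglyMeasurable_starProjection_span_range (hv : ∀ i, AEStronglyMeasurable (v i) P)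
    (hgram : ∀ᵐ ω ∂P, IsUnit (Matrix.gram 𝕜 fun i => v i ω)) (x : E) :
    AEStronglyMeasurable
      (fun ω => (Submodule.span 𝕜 (Set.range fun i => v i ω)).starProjection x) P := by
  have hsum : AEStronglyMeasurable
      (fun ω => ∑ j, ⟪v j ω, x⟫_𝕜 • dualVector 𝕜 (fun i => v i ω) j) P :=
    Finset.aestronglyMeasurable_fun_sum _ fun j _ =>
      ((hv j).inner aestronglyMeasurable_const).smul (aestronglyMeasurable_dualVector hv j)
  refine hsum.congr ?_
  filter_upwards [hgram] with ω hω
  exact (starProjection_span_range_eq_sum hω x).symm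

theorem exists_aeEqFun_ne_zero_ae_mem_orthogonal [NeZero P]
    (hrank : Fintype.card ι < Module.rank 𝕜 E) (hv : ∀ i, AEStronglyMeasurable (v i) P)
    (hgram : ∀ᵐ ω ∂P, IsUnit (Matrix.gram 𝕜 fun i => v i ω)) :
    ∃ W : Ω →ₘ[P] E, W ≠ 0 ∧ ∀ᵐ ω ∂P, W ω ∈ (Submodule.span 𝕜 (Set.range fun i => v i ω))ᗮ := by
  obtain ⟨x, hx⟩ := exists_not_ae_mem_span (P := P) hrank v
  have hmeas := (aestronglyMeasurable_const (b := x)).sub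
    (aestronglyMeasurable_starProjection_span_range hv hgram x)
  refine ⟨AEEqFun.mk _ hmeas, fun hzero => hx ?_, ?_⟩
  · filter_upwards [AEEqFun.mk_eq_mk.1 hzero] with ω hω
    exact Submodule.starProjection_eq_self_iff.1 (sub_eq_zero.1 hω).symm
  · filter_upwards [AEEqFun.coeFn_mk _ hmeas] with ω hω
    rw [hω]
    exact Submodule.sub_starProjection_mem_orthogonal x

theorem infinite_setOf_ae_isDualVector [NeZero P] (hrank : Fintype.card ι < Module.rank 𝕜 E)
    (hv : ∀ i, AEStronglyMeasurable (v i) P)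
    (hgram : ∀ᵐ ω ∂P, IsUnit (Matrix.gram 𝕜 fun i => v i ω)) (k : ι) :
    {U : Ω →ₘ[P] E | ∀ᵐ ω ∂P, IsDualVector 𝕜 (fun i => v i ω) k (U ω)}.Infinite := by
  obtain ⟨W, hW, hWmem⟩ := exists_aeEqFun_ne_zero_ae_mem_orthogonal hrank hv hgram
  have hmeas := aestronglyMeasurable_dualVector (𝕜 := 𝕜) hv k
  refine infinite_of_forall_add_smul_mem (R := 𝕜) (x := AEEqFun.mk _ hmeas) hW fun c => ?_
  filter_upwards [AEEqFun.coeFn_add (AEEqFun.mk _ hmeas) (c • W), AEEqFun.coeFn_smul c W,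
    AEEqFun.coeFn_mk _ hmeas, hWmem, hgram] with ω hadd hsmul hmk hw hω
  rw [hadd, Pi.add_apply, hsmul, hmk]
  exact (isDualVector_dualVector hω k).iff_exists_eq_add.2
    ⟨c • W ω, Submodule.smul_mem _ c hw, rfl⟩

theorem mainTheorem8_general [NeZero P] (hrank : Fintype.card ι < Module.rank 𝕜 E)
    (hv : ∀ i, AEStronglyMeasurable (v i) P)
    (hgram : ∀ᵐ ω ∂P, IsUnit (Matrix.gram 𝕜 fun i => v i ω)) (k : ι) :
    (∀ᵐ ω ∂P,
      (dualVector 𝕜 (fun i => v i ω) k ∈ Submodule.span 𝕜 (Set.range fun i => v i ω) ∧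
        IsDualVector 𝕜 (fun i => v i ω) k (dualVector 𝕜 (fun i => v i ω) k) ∧
        ∀ u ∈ Submodule.span 𝕜 (Set.range fun i => v i ω),
          IsDualVector 𝕜 (fun i => v i ω) k u → u = dualVector 𝕜 (fun i => v i ω) k) ∧
      (∀ u : E, IsDualVector 𝕜 (fun i => v i ω) k u ↔
        ∃ w ∈ (Submodule.span 𝕜 (Set.range fun i => v i ω))ᗮ,
          u = dualVector 𝕜 (fun i => v i ω) k + w) ∧
      {u : E | IsDualVector 𝕜 (fun i => v i ω) k u}.Infinite) ∧
    {U : Ω →ₘ[P] E | ∀ᵐ ω ∂P, IsDualVector 𝕜 (fun i => v i ω) k (U ω)}.Infinite := by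
  refine ⟨?_, infinite_setOf_ae_isDualVector hrank hv hgram k⟩
  filter_upwards [hgram] with ω hω
  have hmem := dualVector_mem_span (𝕜 := 𝕜) (fun i => v i ω) k
  have hdual := isDualVector_dualVector hω k
  exact ⟨⟨hmem, hdual, fun u hu hu' => hdual.eq_of_mem_span hu' hmem hu⟩,
    fun u => hdual.iff_exists_eq_add, hdual.infinite_setOf hrank⟩

end RandomVectors

section SquareIntegrable

variable {𝕜 F : Type*} [RCLike 𝕜] [NormedAddCommGroup F] [InnerProductSpace 𝕜 F]

theorem linearIndependent_indicatorConstLp [CompleteSpace F] {α ι : Type*} [MeasurableSpace α]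
    {μ : Measure α} {s : ι → Set α} (hs : ∀ n, MeasurableSet (s n)) (hfin : ∀ n, μ (s n) ≠ ∞)
    (hpos : ∀ n, μ (s n) ≠ 0) (hdisj : Pairwise (Function.onFun (AEDisjoint μ) s)) {c : F}
    (hc : c ≠ 0) :
    LinearIndependent 𝕜 fun n => indicatorConstLp 2 (hs n) (hfin n) c := by
  refine linearIndependent_of_ne_zero_of_inner_eq_zero (fun n => ?_) fun i j hij => ?_
  · have hinner := L2.inner_indicatorConstLp_indicatorConstLp (𝕜 := 𝕜) (hs n) (hs n)
      (hfin n) (hfin n) c c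
    rw [← inner_self_ne_zero (𝕜 := 𝕜), hinner, Set.inter_self]
    exact smul_ne_zero ((measureReal_ne_zero_iff (hfin n)).2 (hpos n)) (inner_self_ne_zero.2 hc)
  · have hinter : μ (s i ∩ s j) = 0 := hdisj hij
    refine (L2.inner_indicatorConstLp_indicatorConstLp (hs i) (hs j) (hfin i) (hfin j) c c).trans ?_
    rw [measureReal_def, hinter, ENNReal.toReal_zero, zero_smul]

theorem aleph0_le_rank_Lp_restrict_Icc [CompleteSpace F] [Nontrivial F] {α : Type*} [LinearOrder α]
    [TopologicalSpace α] [OrderTopology α] [DenselyOrdered α] [FirstCountableTopology α]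
    [CompactIccSpace α] [MeasurableSpace α] [OpensMeasurableSpace α] (μ : Measure α)
    [μ.IsOpenPosMeasure] [IsFiniteMeasureOnCompacts μ] {a b : α} (hab : a < b) :
    Cardinal.aleph0 ≤ Module.rank 𝕜 (Lp F 2 (μ.restrict (Set.Icc a b))) := by
  obtain ⟨t, ht, hmem, -⟩ := exists_seq_strictMono_tendsto' hab
  obtain ⟨c, hc⟩ := exists_ne (0 : F)
  have hsub (n) : Set.Ioo (t n) (t (n + 1)) ⊆ Set.Icc a b :=
    Set.Ioo_subset_Icc_self.trans (Set.Icc_subset_Icc (hmem n).1.le (hmem (n + 1)).2.le)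
  have hrestrict (n) : μ.restrict (Set.Icc a b) (Set.Ioo (t n) (t (n + 1))) =
      μ (Set.Ioo (t n) (t (n + 1))) := Measure.restrict_eq_self μ (hsub n)
  have hdisj := ht.monotone.pairwise_disjoint_on_Ioo_succ
  refine (linearIndependent_indicatorConstLp (𝕜 := 𝕜) (μ := μ.restrict (Set.Icc a b))
    (s := fun n => Set.Ioo (t n) (t (n + 1))) (fun n => measurableSet_Ioo) (fun n => ?_)
    (fun n => ?_) (fun i j hij => (hdisj hij).aedisjoint) hc).aleph0_le_rank
  · rw [hrestrict]
    exact ((measure_mono (hsub n)).trans_lt isCompact_Icc.measure_lt_top).ne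
  · rw [hrestrict]
    exact ((Measure.measure_Ioo_pos μ).2 (ht n.lt_succ_self)).ne'

end SquareIntegrable

namespace Malliavin

variable {Ω : Type*} {m d : ℕ} {T : ℝ≥0}

theorem coveringField_eq_dualVector (DX : Fin m → Ω → H T d) (k : Fin m) :
    coveringField DX k = fun ω => dualVector ℝ (fun i => DX i ω) k := by
  funext ω
  have hsymm := ((Matrix.isHermitian_gram ℝ fun i => DX i ω).inv).apply k
  simp only [star_trivial] at hsymm
  simp only [dualVector, hsymm]
  rfl

theorem card_lt_rank_of_isUnit_malliavinMatrix (hT : 0 < T) {DX : Fin m → Ω → H T d} {ω : Ω}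
    (hω : IsUnit (malliavinMatrix DX ω)) (k : Fin m) :
    Fintype.card (Fin m) < Module.rank ℝ (H T d) := by
  have hne : DX k ω ≠ 0 := fun h => by
    simpa [h] using isDualVector_dualVector hω k k
  have : Nontrivial (EuclideanSpace ℝ (Fin d)) := by
    by_contra hF
    rw [not_nontrivial_iff_subsingleton] at hF
    exact hne (Lp.ext (ae_of_all _ fun r => Subsingleton.elim _ _))
  exact Cardinal.natCast_lt_aleph0.trans_le (aleph0_le_rank_Lp_restrict_Icc volume hT)

end Malliavin

theorem mainTheorem8 {Ω : Type*} {mΩ : MeasurableSpace Ω} (P : Measure Ω)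
    [IsProbabilityMeasure P] (𝓕 : Filtration ℝ≥0 mΩ) (m d : ℕ) (T : ℝ≥0) (hT : 0 < T)
    (B : ℝ≥0 → Ω → EuclideanSpace ℝ (Fin d)) (hB : Malliavin.IsBrownianMotion 𝓕 P B)
    (b : ℝ → EuclideanSpace ℝ (Fin m) → EuclideanSpace ℝ (Fin m))
    (hb : Measurable (Function.uncurry b))
    (σ : ℝ → EuclideanSpace ℝ (Fin m) → Matrix (Fin m) (Fin d) ℝ)
    (hσ : ∀ i l, Measurable (Function.uncurry fun r y => σ r y i l))
    (x : EuclideanSpace ℝ (Fin m)) (X : ℝ≥0 → Ω → EuclideanSpace ℝ (Fin m))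
    (hX : Malliavin.IsSDESolution 𝓕 P B T b σ x X)
    (DX : Fin m → Ω → Malliavin.H T d)
    (hDX : ∀ i, Malliavin.IsMalliavinDeriv 𝓕 P B T (fun ω => X T ω i) (DX i))
    (hγ : ∀ᵐ ω ∂P, IsUnit (Malliavin.malliavinMatrix DX ω))
    (k : Fin m) :
    (∀ᵐ ω ∂P,
      -- `u_k` is the unique element of `V` with the covering property
      (Malliavin.coveringField DX k ω ∈ Malliavin.derivSpan DX ω ∧
        Malliavin.Covers DX k ω (Malliavin.coveringField DX k ω) ∧
        ∀ v ∈ Malliavin.derivSpan DX ω, Malliavin.Covers DX k ω v →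
          v = Malliavin.coveringField DX k ω) ∧
      -- the elements of `L²([0, T], ℝ^d)` with the covering property are the `u_k + w`, `w ∈ Vᗮ`,
      -- and there are infinitely many of them
      (∀ u : Malliavin.H T d, Malliavin.Covers DX k ω u ↔
        ∃ w ∈ (Malliavin.derivSpan DX ω)ᗮ, u = Malliavin.coveringField DX k ω + w) ∧
      {u : Malliavin.H T d | Malliavin.Covers DX k ω u}.Infinite) ∧
    -- there are infinitely many random covering fields, up to almost sure equality
    {U : Ω →ₘ[P] Malliavin.H T d | ∀ᵐ ω ∂P, Malliavin.Covers DX k ω (U ω)}.Infinite := by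
  obtain ⟨ω₀, hω₀⟩ := hγ.exists
  rw [Malliavin.coveringField_eq_dualVector]
  exact mainTheorem8_general (Malliavin.card_lt_rank_of_isUnit_malliavinMatrix hT hω₀ k)
    (fun i => (hDX i).2.1.aestronglyMeasurable) hγ k
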